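/- **Global empirical loss reduction for WeightNorm under square loss.** Setting. Let $d,m,L,n\ge 1$ be integers, and put $m_0=d$, $m_1=\dots=m_L=m$. For parameters $\theta=(W^{(1)},\dots,W^{(L)},\mathbf v)$, with $W^{(l)}\in\mathbb R^{m_l\times m_{l-1}}$ having rows $W^{(l)}_i\neq 0$ and $\mathbf v\in\mathbb R^{m}$, let $$\alpha^{(0)}=\mathbf x,\qquad \alpha^{(l)}_i=\phi\Big(\tfrac1{\sqrt m}\tfrac{\langle W_i^{(l)},\alpha^{(l-1)}\rangle}{\|W_i^{(l)}\|_2}\Big)\quad(1\le l\le L,\ 1\le i\le m),\qquad f(\theta;\mathbf x)=\mathbf v^\top\alpha^{(L)},$$ and $\mathcal L(\theta)=\frac1n\sum_{i=1}^n(y_i-f(\theta;\mathbf x_i))^2$. Here $\phi:\mathbb R\to\mathbb R$ is $C^2$ with $|\phi'|\le1$ and $|\phi''|\le\beta_\phi$, the data satisfy $\|\mathbf x_i\|_2=1$ and $\frac1n\sum_i y_i^2\le Y$. Let $\kappa\in(0,1]$ and $\rho_1,\rho_2>0$. Write $w_\theta=\min_{l,i}\|W^{(l)}_i\|_2$ and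 $M=\max\{|\phi(0)|,|\phi(0)|^2\}$, and for constants $C_\alpha\ge 0$, $C_\beta>0$ put $$\alpha_\theta=\frac{\kappa^2}{2}\frac{\|\nabla\mathcal L(\theta)\|_2^2}{\mathcal L(\theta)}-C_\alpha\Big(1+\frac{\sqrt L}{w_\theta}\Big)\frac{(1+\rho_2)(1+\rho_1)^3L^3\big(\frac1{\sqrt m}+L^2M\big)\big(1+L|\phi(0)|\sqrt m\big)}{\min\{w_\theta,w_\theta^2\}},$$ $$\beta_\theta=C_\beta\,L^4(1+L^2Mm)^2(1+\rho_1)^2\Big(1+\frac1{\min\{w_\theta,w_\theta^2\}}\Big).$$ Theorem. There is a constant $C_0>0$, depending only on $\beta_\phi$ and $Y$, such that the following holds for all $C_\alpha\ge0$, all $C_\beta\ge C_0$ and every setting as above. Let $\theta_0,\dots,\theta_T$ be parameters with output layers $\mathbf v_0,\dots,\mathbf v_T$, such that all weight rows of $\theta_0$ are nonzero, $\|\mathbf v_0\|_2=1$ and * $\alpha_{\theta_t}>0$ for $t<T$; * $\theta_{t+1}=\theta_t-\frac{\omega_t}{\beta_{\theta_t}}\nabla\mathcal L(\theta_t)$ with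 $\omega_t\in(0,2)$ for $t<T$, and $\|\mathbf v_t-\mathbf v_0\|_2\le\rho_1$ for $t\le T$; * $\|\theta_{t+1}-\theta_t\|_2\le\rho_2$ for $t<T$. Let $\mathcal F$ be the set of $\theta$ with nonzero weight rows and $\|\mathbf v-\mathbf v_0\|_2\le\rho_1$, and let $\theta^*$ minimize $\mathcal L$ over $\mathcal F$. Let $t<T$, let $\overline\theta_{t+1}$ minimize $\mathcal L$ over $$B_t=\{\theta\in\mathcal F:\ |\cos(\theta-\theta_t,\nabla\mathcal L(\theta_t))|\ge\kappa,\ \|\theta-\theta_t\|_2\le\rho_2\},$$ and let $\gamma_t=\dfrac{\mathcal L(\overline\theta_{t+1})-\mathcal L(\theta^*)}{\mathcal L(\theta_t)-\mathcal L(\theta^*)}$. Then $\mathcal L(\theta_t)>\mathcal L(\theta^*)$ (so $\gamma_t$ is well defined), $\gamma_t\in[0,1)$, $$\mathcal L(\theta_{t+1})-\mathcal L(\theta^*)\le\Big(1-\frac{\alpha_{\theta_t}}{\beta_{\theta_t}}\omega_t(1-\gamma_t)(2-\omega_t)\Big)\big(\mathcal L(\theta_t)-\mathcal L(\theta^*)\big),$$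 and the factor $1-\frac{\alpha_{\theta_t}}{\beta_{\theta_t}}\omega_t(1-\gamma_t)(2-\omega_t)$ is strictly less than $1$. -/

import Mathlib

namespace WeightNorm

noncomputable section

/-- Layer widths: the input layer has width `d`, every hidden layer has width `m`. -/
def width (d m : ℕ) : ℕ → ℕ
  | 0 => d
  | _ + 1 => m

/-- Coordinates of the parameter vector: the entries of the weight matrices of the `N` hidden
layers (layer `l + 1` has index `l : Fin N` and is an `m × width l` matrix), followed by the
entries of the output layer. -/
abbrev ParamIndex (d m N : ℕ) : Type :=
  (Σ l : Fin N, Fin m × Fin (width d m l)) ⊕ Fin (width d m N)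

/-- The parameter space `ℝ^p` with its Euclidean norm. -/
abbrev Param (d m N : ℕ) : Type := EuclideanSpace ℝ (ParamIndex d m N)

/-- The weight vector of unit `i` of hidden layer `l + 1` (the `i`-th row of the weight matrix). -/
def weightRow {d m N : ℕ} (θ : Param d m N) (l : Fin N) (i : Fin m) :
    EuclideanSpace ℝ (Fin (width d m l)) :=
  WithLp.toLp 2 fun j => θ (Sum.inl ⟨l, (i, j)⟩)

/-- The output layer `v`. -/
def outLayer {d m N : ℕ} (θ : Param d m N) : EuclideanSpace ℝ (Fin (width d m N)) :=
  WithLp.toLp 2 fun j => θ (Sum.inr j)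

/-- The activation vector of layer `l ≤ N`: layer `0` is the input, and unit `i` of layer `l + 1`
has value `φ (m^{-1/2} ⟨W_i / ‖W_i‖, (activation of layer l)⟩)`. -/
def layerOut {d m N : ℕ} (φ : ℝ → ℝ) (θ : Param d m N) (x : EuclideanSpace ℝ (Fin d)) :
    (l : ℕ) → l ≤ N → EuclideanSpace ℝ (Fin (width d m l))
  | 0, _ => x
  | l + 1, h => WithLp.toLp 2 fun i : Fin m =>
      φ (1 / √(m : ℝ) *
        (inner ℝ (weightRow θ ⟨l, h⟩ i) (layerOut φ θ x l (Nat.le_of_succ_le h)) /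
          ‖weightRow θ ⟨l, h⟩ i‖))

/-- The network output `f(θ; x) = ⟨v, α^{(N)}(x)⟩`. -/
def predictor {d m N : ℕ} (φ : ℝ → ℝ) (θ : Param d m N) (x : EuclideanSpace ℝ (Fin d)) : ℝ :=
  inner ℝ (outLayer θ) (layerOut φ θ x N le_rfl)

/-- The empirical square loss. -/
def empLoss {d m N n : ℕ} (φ : ℝ → ℝ) (x : Fin n → EuclideanSpace ℝ (Fin d)) (y : Fin n → ℝ)
    (θ : Param d m N) : ℝ :=
  1 / (n : ℝ) * ∑ i, (y i - predictor φ θ (x i)) ^ 2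

/-- The parameters at which the normalized network is defined: no weight vector vanishes. -/
def nondegenerate (d m N : ℕ) : Set (Param d m N) :=
  {θ | ∀ l i, weightRow θ l i ≠ 0}

/-- The minimum weight vector norm (over all units of all hidden layers). -/
def minRowNorm {d m N : ℕ} (θ : Param d m N) : ℝ :=
  ⨅ k : Fin N × Fin m, ‖weightRow θ k.1 k.2‖

/-- `Q^θ_κ` for a function `F`: the points `θ'` with `|cos(θ' - θ, ∇F(θ))| ≥ κ`. -/
def coneSet {d m N : ℕ} (F : Param d m N → ℝ) (κ : ℝ) (θ : Param d m N) : Set (Param d m N) :=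
  {θ' | κ ≤ |Real.cos (InnerProductGeometry.angle (θ' - θ) (gradient F θ))|}

/-- The parameters of well-defined networks whose output layer lies in the closed Euclidean ball
of radius `ρ₁` around `v₀`. -/
def feasibleSet {d m N : ℕ} (v₀ : EuclideanSpace ℝ (Fin (width d m N))) (ρ₁ : ℝ) :
    Set (Param d m N) :=
  {θ | θ ∈ nondegenerate d m N ∧ outLayer θ ∈ Metric.closedBall v₀ ρ₁}

/-- The restricted strong convexity parameter `α_θ`; `C` is the constant hidden in its
`O`-term. -/
def rscParam {d m N n : ℕ} (C : ℝ) (φ : ℝ → ℝ) (x : Fin n → EuclideanSpace ℝ (Fin d))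
    (y : Fin n → ℝ) (κ ρ₁ ρ₂ : ℝ) (θ : Param d m N) : ℝ :=
  κ ^ 2 / 2 * (‖gradient (empLoss φ x y) θ‖ ^ 2 / empLoss φ x y θ) -
    C * ((1 + √(N : ℝ) / minRowNorm θ) *
      ((1 + ρ₂) * (1 + ρ₁) ^ 3 * (N : ℝ) ^ 3 *
        (1 / √(m : ℝ) + (N : ℝ) ^ 2 * max |φ 0| (|φ 0| ^ 2)) *
        (1 + (N : ℝ) * (|φ 0| * √(m : ℝ))) /
        min (minRowNorm θ) (minRowNorm θ ^ 2)))

/-- The smoothness parameter `β_θ`; `C` is the constant hidden in its `O`-term. -/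
def smoothParam {d m N : ℕ} (C : ℝ) (φ : ℝ → ℝ) (ρ₁ : ℝ) (θ : Param d m N) : ℝ :=
  C * ((N : ℝ) ^ 4 * (1 + (N : ℝ) ^ 2 * max |φ 0| (|φ 0| ^ 2) * (m : ℝ)) ^ 2 * (1 + ρ₁) ^ 2 *
    (1 + 1 / min (minRowNorm θ) (minRowNorm θ ^ 2)))

end

end WeightNorm

/-! The key is the scale invariance of weight normalization. The loss does not change when a weight
row is multiplied by a positive number, so its gradient is orthogonal to every row
(`inner_weightRow_gradient`). By Pythagoras, moving along the gradient never shortens a row. On the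
whole line through `θ` in the gradient direction, all rows therefore keep norm at least `minRowNorm
θ`, although the normalized network is singular at zero rows.

On such a line the network is a composition of curves with two bounded derivatives. Propagating
these bounds through the layers bounds the second derivative of the loss on the step's segment by
`smoothParam` at the starting point times `‖∇‖ ^ 2` (`empLoss_line_deriv_two`,
`empLoss_gradient_step_le`). A step `ω / β` thus lowers the loss by at least `ω (2 - ω) / β * (‖∇‖ ^
2 / 2)`.

No convexity is needed for the other half. Since `α ≤ κ ^ 2 / 2 * ‖∇‖ ^ 2 / loss` and the loss is
nonnegative, `α * (loss θ_t - loss θbar) ≤ ‖∇‖ ^ 2 / 2`. The difference of losses equals `(1 - γ)`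
times the gap at `θ_t`, which gives the contraction. The next iterate competes in the minimization
defining `θbar`, so `loss θbar ≤ loss θ_{t+1} < loss θ_t`, whence `γ < 1`. -/

namespace WeightNorm

/-! ### Calculus of curves with two bounded derivatives. -/

/-- `f` is twice differentiable at the points of `I`, with `f`, `f'` and `f''` bounded in norm by
`A`, `B` and `C` there. -/
def BoundedC2 {E : Type*} [NormedAddCommGroup E] [NormedSpace ℝ E] (I : Set ℝ) (f : ℝ → E)
    (A B C : ℝ) : Prop :=
  ∃ f₁ f₂ : ℝ → E, ∀ s ∈ I, HasDerivAt f (f₁ s) s ∧ HasDerivAt f₁ (f₂ s) s ∧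
    ‖f s‖ ≤ A ∧ ‖f₁ s‖ ≤ B ∧ ‖f₂ s‖ ≤ C

namespace BoundedC2

variable {E : Type*} [NormedAddCommGroup E] {I : Set ℝ}

theorem mono [NormedSpace ℝ E] {f : ℝ → E} {A B C A' B' C' : ℝ} (h : BoundedC2 I f A B C)
    (hA : A ≤ A') (hB : B ≤ B') (hC : C ≤ C') : BoundedC2 I f A' B' C' := by
  obtain ⟨f₁, f₂, h⟩ := h
  exact ⟨f₁, f₂, fun s hs => ⟨(h s hs).1, (h s hs).2.1, (h s hs).2.2.1.trans hA,
    (h s hs).2.2.2.1.trans hB, (h s hs).2.2.2.2.trans hC⟩⟩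

theorem const [NormedSpace ℝ E] (a : E) : BoundedC2 I (fun _ => a) ‖a‖ 0 0 :=
  ⟨fun _ => 0, fun _ => 0, fun s _ => ⟨hasDerivAt_const s a, hasDerivAt_const s 0, le_rfl, by simp,
    by simp⟩⟩

theorem real_inner [InnerProductSpace ℝ E] {f g : ℝ → E} {A B C A' B' C' : ℝ}
    (hf : BoundedC2 I f A B C) (hg : BoundedC2 I g A' B' C') :
    BoundedC2 I (fun s => inner ℝ (f s) (g s)) (A * A') (A * B' + B * A')
      (A * C' + 2 * (B * B') + C * A') := by
  obtain ⟨f₁, f₂, hf⟩ := hf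
  obtain ⟨g₁, g₂, hg⟩ := hg
  have key : ∀ {a b : E} {p q : ℝ}, ‖a‖ ≤ p → ‖b‖ ≤ q → |inner ℝ a b| ≤ p * q :=
    fun {a b p q} ha hb => (abs_real_inner_le_norm a b).trans
      (mul_le_mul ha hb (norm_nonneg b) ((norm_nonneg a).trans ha))
  refine ⟨fun s => inner ℝ (f s) (g₁ s) + inner ℝ (f₁ s) (g s),
    fun s => (inner ℝ (f s) (g₂ s) + inner ℝ (f₁ s) (g₁ s)) +
      (inner ℝ (f₁ s) (g₁ s) + inner ℝ (f₂ s) (g s)), fun s hs => ?_⟩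
  obtain ⟨f0, f1, fA, fB, fC⟩ := hf s hs
  obtain ⟨g0, g1, gA, gB, gC⟩ := hg s hs
  refine ⟨f0.inner ℝ g0, (f0.inner ℝ g1).add (f1.inner ℝ g0), ?_, ?_, ?_⟩
  · exact key fA gA
  · exact (abs_add_le _ _).trans (add_le_add (key fA gB) (key fB gA))
  · refine (abs_add_le _ _).trans ((add_le_add (abs_add_le _ _) (abs_add_le _ _)).trans ?_)
    linarith [key fA gC, key fB gB, key fC gA]

theorem const_mul {f : ℝ → ℝ} {A B C c : ℝ} (hf : BoundedC2 I f A B C) (hc : 0 ≤ c) :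
    BoundedC2 I (fun s => c * f s) (c * A) (c * B) (c * C) := by
  obtain ⟨f₁, f₂, hf⟩ := hf
  refine ⟨fun s => c * f₁ s, fun s => c * f₂ s, fun s hs => ?_⟩
  obtain ⟨f0, f1, fA, fB, fC⟩ := hf s hs
  refine ⟨f0.const_mul c, f1.const_mul c, ?_, ?_, ?_⟩ <;>
  · rw [norm_mul, Real.norm_of_nonneg hc]
    gcongr

theorem comp_of_deriv_le {φ : ℝ → ℝ} {β : ℝ} (hφ : ContDiff ℝ 2 φ) (h1 : ∀ z, |deriv φ z| ≤ 1)
    (h2 : ∀ z, |deriv (deriv φ) z| ≤ β) {f : ℝ → ℝ} {A B C : ℝ} (hf : BoundedC2 I f A B C) :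
    BoundedC2 I (fun s => φ (f s)) (|φ 0| + A) B (β * B ^ 2 + C) := by
  obtain ⟨f₁, f₂, hf⟩ := hf
  have d1 : ∀ z, HasDerivAt φ (deriv φ z) z := fun z =>
    (hφ.differentiable (by norm_num) z).hasDerivAt
  have d2 : ∀ z, HasDerivAt (deriv φ) (deriv (deriv φ) z) z := fun z =>
    ((hφ.deriv' (n := 1)).differentiable (by norm_num) z).hasDerivAt
  refine ⟨fun s => deriv φ (f s) * f₁ s,
    fun s => deriv (deriv φ) (f s) * f₁ s * f₁ s + deriv φ (f s) * f₂ s, fun s hs => ?_⟩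
  obtain ⟨f0, f1, fA, fB, fC⟩ := hf s hs
  refine ⟨(d1 _).comp s f0, ((d2 _).comp s f0).mul f1, ?_, ?_, ?_⟩
  · have h := Convex.norm_image_sub_le_of_norm_deriv_le (f := φ) (C := 1) (s := Set.univ)
      (fun z _ => (d1 z).differentiableAt) (fun z _ => h1 z) convex_univ (Set.mem_univ 0)
      (Set.mem_univ (f s))
    have h' := norm_le_norm_add_norm_sub' (φ (f s)) (φ 0)
    rw [sub_zero, one_mul] at h
    rw [Real.norm_eq_abs (φ 0)] at h'
    linarith
  · rw [norm_mul]
    exact (mul_le_of_le_one_left (norm_nonneg _) (h1 _)).trans fB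
  · refine (norm_add_le _ _).trans (add_le_add ?_ ?_)
    · rw [mul_assoc, norm_mul, norm_mul, ← sq]
      exact mul_le_mul (h2 _) (pow_le_pow_left₀ (norm_nonneg _) fB 2) (by positivity)
        ((abs_nonneg _).trans (h2 0))
    · rw [norm_mul]
      exact (mul_le_of_le_one_left (norm_nonneg _) (h1 _)).trans fC

/-- A vector with `m` entries of size at most `A / √m` has Euclidean norm at most `A`. The factor `1
/ √m` in each unit thus keeps the layer bounds from growing by a factor `√m` at each layer. -/
theorem toLp_of_forall {m : ℕ} (hm : 1 ≤ m) {f : Fin m → ℝ → ℝ} {A B C : ℝ}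
    (hf : ∀ i, BoundedC2 I (f i) (1 / √m * A) (1 / √m * B) (1 / √m * C)) :
    BoundedC2 I (fun s => (WithLp.toLp 2 fun i => f i s : EuclideanSpace ℝ (Fin m))) A B C := by
  choose f₁ f₂ hf using hf
  have key : ∀ {v : Fin m → ℝ} {A : ℝ}, (∀ i, ‖v i‖ ≤ 1 / √m * A) →
      ‖(WithLp.toLp 2 v : EuclideanSpace ℝ (Fin m))‖ ≤ A := by
    intro v A h
    have hm' : (0 : ℝ) < m := by exact_mod_cast hm
    have hA : 0 ≤ A :=
      nonneg_of_mul_nonneg_right ((norm_nonneg _).trans (h ⟨0, hm⟩)) (by positivity)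
    refine (sq_le_sq₀ (norm_nonneg _) hA).1 ?_
    rw [EuclideanSpace.norm_sq_eq]
    calc ∑ i, ‖v i‖ ^ 2 ≤ ∑ _i : Fin m, (1 / √m * A) ^ 2 :=
          Finset.sum_le_sum fun i _ => pow_le_pow_left₀ (norm_nonneg _) (h i) 2
      _ = A ^ 2 := by
          rw [Finset.sum_const, Finset.card_univ, Fintype.card_fin, nsmul_eq_mul, mul_pow,
            div_pow, Real.sq_sqrt hm'.le]
          field_simp
  refine ⟨fun s => WithLp.toLp 2 fun i => f₁ i s, fun s => WithLp.toLp 2 fun i => f₂ i s,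
    fun s hs => ⟨?_, ?_, ?_, ?_, ?_⟩⟩
  · exact (PiLp.hasFDerivAt_toLp 2 _).comp_hasDerivAt s (hasDerivAt_pi.2 fun i => (hf i s hs).1)
  · exact (PiLp.hasFDerivAt_toLp 2 _).comp_hasDerivAt s (hasDerivAt_pi.2 fun i => (hf i s hs).2.1)
  · exact key fun i => (hf i s hs).2.2.1
  · exact key fun i => (hf i s hs).2.2.2.1
  · exact key fun i => (hf i s hs).2.2.2.2

/-- The direction of a point moving on a line at distance at least `w` from the origin. -/
theorem inv_norm_smul_line [InnerProductSpace ℝ E] (a u : E) {w b : ℝ} (hw : 0 < w)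
    (hu : ‖u‖ ≤ b) (h : ∀ s : ℝ, w ≤ ‖a + s • u‖) :
    BoundedC2 I (fun s : ℝ => ‖a + s • u‖⁻¹ • (a + s • u)) 1 (2 * (b / w)) (6 * (b / w) ^ 2) := by
  have hc : ∀ s : ℝ, HasDerivAt (fun s : ℝ => a + s • u) u s := fun s => by
    simpa using ((hasDerivAt_id s).smul_const u).const_add a
  set c : ℝ → E := fun s => a + s • u with hcdef
  have hpos : ∀ s, 0 < ‖c s‖ := fun s => hw.trans_le (h s)
  have hρ : ∀ s, HasDerivAt (fun s => ‖c s‖⁻¹) (-(inner ℝ (c s) u * ‖c s‖⁻¹ ^ 3)) s := by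
    intro s
    have h1 : HasDerivAt (fun s => ‖c s‖) (inner ℝ (c s) u / ‖c s‖) s := by
      have h2 := ((hc s).norm_sq).sqrt (pow_ne_zero 2 (hpos s).ne')
      simp only [Real.sqrt_sq (norm_nonneg _)] at h2
      convert h2 using 1
      field_simp
    refine (h1.inv (hpos s).ne').congr_deriv ?_
    have := (hpos s).ne'
    field_simp
  have hi : ∀ s, HasDerivAt (fun s => inner ℝ (c s) u) (‖u‖ ^ 2) s := by
    intro s
    simpa using (hc s).inner ℝ (hasDerivAt_const s u)
  have hin : ∀ s, |inner ℝ (c s) u| ≤ ‖c s‖ * ‖u‖ := fun s => abs_real_inner_le_norm _ _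
  have hq : ∀ s, ‖c s‖⁻¹ * ‖u‖ ≤ b / w := fun s => by
    rw [div_eq_inv_mul]
    exact mul_le_mul (inv_anti₀ hw (h s)) hu (norm_nonneg _) (by positivity)
  -- The first derivative has two terms of norm at most `‖u‖ / ‖c s‖`, hence the constant 2. The
  -- second has two terms bounded by the square of that ratio and one, `e2`, bounded by 1 + 3 = 4
  -- times it, hence 6.
  refine ⟨fun s => ‖c s‖⁻¹ • u + (-(inner ℝ (c s) u * ‖c s‖⁻¹ ^ 3)) • c s,
    fun s => (-(inner ℝ (c s) u * ‖c s‖⁻¹ ^ 3)) • u +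
      ((-(inner ℝ (c s) u * ‖c s‖⁻¹ ^ 3)) • u +
      (-(‖u‖ ^ 2 * ‖c s‖⁻¹ ^ 3 + inner ℝ (c s) u *
        (3 * ‖c s‖⁻¹ ^ 2 * -(inner ℝ (c s) u * ‖c s‖⁻¹ ^ 3)))) • c s), fun s _ => ?_⟩
  have e1 : |inner ℝ (c s) u * ‖c s‖⁻¹ ^ 3| ≤ ‖c s‖⁻¹ ^ 2 * ‖u‖ := by
    rw [abs_mul, abs_of_pos (pow_pos (inv_pos.2 (hpos s)) 3)]
    calc _ ≤ ‖c s‖ * ‖u‖ * ‖c s‖⁻¹ ^ 3 := by gcongr; exact hin s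
      _ = _ := by have := (hpos s).ne'; field_simp
  have hr : 0 < ‖c s‖⁻¹ := inv_pos.2 (hpos s)
  have hone : ‖c s‖⁻¹ * ‖c s‖ = 1 := inv_mul_cancel₀ (hpos s).ne'
  have e2 : |‖u‖ ^ 2 * ‖c s‖⁻¹ ^ 3 + inner ℝ (c s) u *
        (3 * ‖c s‖⁻¹ ^ 2 * -(inner ℝ (c s) u * ‖c s‖⁻¹ ^ 3))| ≤ 4 * (‖u‖ ^ 2 * ‖c s‖⁻¹ ^ 3) := by
    have hh : |inner ℝ (c s) u * (3 * ‖c s‖⁻¹ ^ 2 * -(inner ℝ (c s) u * ‖c s‖⁻¹ ^ 3))| ≤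
        3 * (‖u‖ ^ 2 * ‖c s‖⁻¹ ^ 3) := by
      rw [abs_mul, abs_mul, abs_neg, abs_of_pos (by positivity : 0 < 3 * ‖c s‖⁻¹ ^ 2)]
      calc _ ≤ ‖c s‖ * ‖u‖ * (3 * ‖c s‖⁻¹ ^ 2 * (‖c s‖⁻¹ ^ 2 * ‖u‖)) := by
            gcongr; exact hin s
        _ = _ := by have := (hpos s).ne'; field_simp
    have h0 : |‖u‖ ^ 2 * ‖c s‖⁻¹ ^ 3| = ‖u‖ ^ 2 * ‖c s‖⁻¹ ^ 3 := abs_of_nonneg (by positivity)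
    linarith [abs_add_le (‖u‖ ^ 2 * ‖c s‖⁻¹ ^ 3) (inner ℝ (c s) u *
        (3 * ‖c s‖⁻¹ ^ 2 * -(inner ℝ (c s) u * ‖c s‖⁻¹ ^ 3)))]
  refine ⟨(hρ s).smul (hc s), ?_, ?_, ?_, ?_⟩
  · refine ((hρ s).smul_const u).add ?_
    have := (((hi s).mul ((hρ s).pow 3)).neg).smul (hc s)
    refine this.congr_deriv ?_
    norm_num [Pi.mul_apply, Pi.pow_apply]
  · rw [norm_smul, norm_inv, norm_norm, hone]
  · refine (norm_add_le _ _).trans ?_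
    rw [norm_smul, norm_smul, norm_neg, norm_inv, norm_norm, Real.norm_eq_abs]
    calc _ ≤ ‖c s‖⁻¹ * ‖u‖ + ‖c s‖⁻¹ ^ 2 * ‖u‖ * ‖c s‖ := by gcongr
      _ = 2 * (‖c s‖⁻¹ * ‖u‖) := by have := (hpos s).ne'; field_simp; norm_num
      _ ≤ _ := by gcongr; exact hq s
  · refine (norm_add_le _ _).trans
      ((add_le_add le_rfl (norm_add_le _ _)).trans ?_)
    simp only [norm_smul, norm_neg, Real.norm_eq_abs]
    calc _ ≤ ‖c s‖⁻¹ ^ 2 * ‖u‖ * ‖u‖ + (‖c s‖⁻¹ ^ 2 * ‖u‖ * ‖u‖ +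
          4 * (‖u‖ ^ 2 * ‖c s‖⁻¹ ^ 3) * ‖c s‖) := by gcongr
      _ = 6 * (‖c s‖⁻¹ * ‖u‖) ^ 2 := by have := (hpos s).ne'; field_simp; norm_num
      _ ≤ _ := by gcongr; exact hq s

end BoundedC2

/-! ### The network and the loss along a line in parameter space. -/

section

variable {d m N : ℕ}

theorem weightRow_add_smul (θ u : Param d m N) (s : ℝ) (l : Fin N) (i : Fin m) :
    weightRow (θ + s • u) l i = weightRow θ l i + s • weightRow u l i := rfl

theorem outLayer_add_smul (θ u : Param d m N) (s : ℝ) :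
    outLayer (θ + s • u) = outLayer θ + s • outLayer u := rfl

theorem norm_weightRow_le (u : Param d m N) (l : Fin N) (i : Fin m) : ‖weightRow u l i‖ ≤ ‖u‖ := by
  refine (sq_le_sq₀ (norm_nonneg _) (norm_nonneg _)).1 ?_
  rw [EuclideanSpace.norm_sq_eq, EuclideanSpace.norm_sq_eq]
  let e : Fin (width d m l) ↪ ParamIndex d m N :=
    ⟨fun j => Sum.inl ⟨l, (i, j)⟩, fun j k h => by simpa using h⟩
  have h := Finset.sum_map Finset.univ e fun k => ‖u k‖ ^ 2
  exact h.symm.le.trans (Finset.sum_le_sum_of_subset_of_nonneg (Finset.subset_univ _)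
    fun _ _ _ => by positivity)

theorem norm_outLayer_le (u : Param d m N) : ‖outLayer u‖ ≤ ‖u‖ := by
  refine (sq_le_sq₀ (norm_nonneg _) (norm_nonneg _)).1 ?_
  rw [EuclideanSpace.norm_sq_eq, EuclideanSpace.norm_sq_eq]
  have h := Finset.sum_map Finset.univ (Function.Embedding.inr : _ ↪ ParamIndex d m N)
    fun k => ‖u k‖ ^ 2
  exact h.symm.le.trans (Finset.sum_le_sum_of_subset_of_nonneg (Finset.subset_univ _)
    fun _ _ _ => by positivity)

/-- The activations of a layer along a line in parameter space on which the weight rows stay away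
from the origin. -/
theorem layerOut_boundedC2 {φ : ℝ → ℝ} {β : ℝ} (hφ : ContDiff ℝ 2 φ)
    (h1 : ∀ z, |deriv φ z| ≤ 1) (h2 : ∀ z, |deriv (deriv φ) z| ≤ β) (hm : 1 ≤ m)
    {x : EuclideanSpace ℝ (Fin d)} (hx : ‖x‖ = 1) (I : Set ℝ) (θ u : Param d m N) {w : ℝ}
    (hw : 0 < w) (hrow : ∀ l i (s : ℝ), w ≤ ‖weightRow (θ + s • u) l i‖) {A q : ℝ}
    (hA : A = 1 + N * (|φ 0| * √m)) (hq : q = ‖u‖ / w) :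
    ∀ (l : ℕ) (hl : l ≤ N), BoundedC2 I (fun s => layerOut φ (θ + s • u) x l hl)
      (1 + l * (|φ 0| * √m)) (l * (2 * (q * A)))
      (l * (N ^ 2 * (4 * β + 8) * (q * A) ^ 2)) := by
  have hq0 : 0 ≤ q := hq ▸ div_nonneg (norm_nonneg _) hw.le
  have hp : 0 ≤ |φ 0| * √m := by positivity
  have hA1 : 1 ≤ A := by rw [hA]; nlinarith [(Nat.cast_nonneg N : (0 : ℝ) ≤ N)]
  have hβ : 0 ≤ β := (abs_nonneg _).trans (h2 0)
  have hm' : (0 : ℝ) < √m := Real.sqrt_pos.2 (by exact_mod_cast hm)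
  intro l
  induction l with
  | zero =>
    intro _
    refine (BoundedC2.const x).mono ?_ ?_ ?_ <;> simp [hx]
  | succ l ih =>
    intro hl
    have hlN : (l : ℝ) + 1 ≤ N := by exact_mod_cast hl
    have hl0 : (0 : ℝ) ≤ l := Nat.cast_nonneg l
    have hAl : 1 + l * (|φ 0| * √m) ≤ A := by
      rw [hA]; gcongr; linarith
    refine BoundedC2.toLp_of_forall hm fun i => ?_
    have hν := BoundedC2.inv_norm_smul_line (I := I) (weightRow θ ⟨l, hl⟩ i)
      (weightRow u ⟨l, hl⟩ i) hw (norm_weightRow_le u _ _) (hrow ⟨l, hl⟩ i)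
    rw [← hq] at hν
    have hz := ((hν.real_inner (ih (Nat.le_of_succ_le hl))).const_mul
      (by positivity : 0 ≤ 1 / √(m : ℝ))).comp_of_deriv_le hφ h1 h2
    simp only [real_inner_smul_left, ← div_eq_inv_mul] at hz
    have hA0 : 0 ≤ A := zero_le_one.trans hA1
    have hqA : 0 ≤ q * A := by positivity
    -- By the product rule each layer adds at most `2 * (q * A)` to the first derivative, which
    -- yields linear growth in `l`.
    have hB : 1 * (l * (2 * (q * A))) + 2 * q * (1 + l * (|φ 0| * √m)) ≤
        (l + 1) * (2 * (q * A)) := by nlinarith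
    have hB0 : 0 ≤ 1 * (l * (2 * (q * A))) + 2 * q * (1 + l * (|φ 0| * √m)) := by positivity
    refine hz.mono (le_of_eq ?_) ?_ ?_
    · push_cast
      field_simp
      ring
    · push_cast
      gcongr
    · have hr1 : 1 / √(m : ℝ) ≤ 1 := by
        rw [div_le_one hm']
        exact Real.one_le_sqrt.2 (by exact_mod_cast hm)
      have hr0 : 0 ≤ 1 / √(m : ℝ) := by positivity
      set r := 1 / √(m : ℝ)
      -- The term `φ'' * f' ^ 2` carries `r ^ 2`. One factor `r ≤ 1` is dropped and the other is
      -- kept, as `toLp_of_forall` requires.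
      have hsq : β * (r * (1 * (l * (2 * (q * A))) + 2 * q * (1 + l * (|φ 0| * √m)))) ^ 2 ≤
          r * (β * (N * (2 * (q * A))) ^ 2) := by
        calc _ ≤ β * (r * (N * (2 * (q * A)))) ^ 2 := by
              gcongr
              exact hB.trans (by gcongr)
          _ = r * (r * (β * (N * (2 * (q * A))) ^ 2)) := by ring
          _ ≤ _ := mul_le_mul_of_nonneg_left (mul_le_of_le_one_left (by positivity) hr1) hr0
      have hN1 : (1 : ℝ) ≤ N := by linarith
      have hC : 2 * (2 * q * (l * (2 * (q * A)))) + 6 * q ^ 2 * (1 + l * (|φ 0| * √m)) ≤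
          8 * N ^ 2 * (q * A) ^ 2 := by
        calc _ ≤ 2 * (2 * q * (l * (2 * (q * A)))) + 6 * q ^ 2 * A := by gcongr
          _ = q ^ 2 * A * (8 * l + 6) := by ring
          _ ≤ q ^ 2 * (A * A) * (8 * (N * N)) := by
              gcongr
              · exact le_mul_of_one_le_left (by linarith) hA1
              · nlinarith
          _ = _ := by ring
      calc _ ≤ r * (β * (N * (2 * (q * A))) ^ 2) + r * (l * (N ^ 2 * (4 * β + 8) * (q * A) ^ 2) +
            8 * N ^ 2 * (q * A) ^ 2) := by
            refine add_le_add hsq (mul_le_mul_of_nonneg_left ?_ hr0)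
            linarith
        _ = _ := by push_cast; ring

/-- Unlike the weight rows, the output layer is controlled only on the segment of the step. This is
why the bounds are relative to a set `I`. -/
theorem outLayer_line_boundedC2 {I : Set ℝ} (θ u : Param d m N) {V : ℝ}
    (hV : ∀ s ∈ I, ‖outLayer (θ + s • u)‖ ≤ V) :
    BoundedC2 I (fun s : ℝ => outLayer (θ + s • u)) V ‖u‖ 0 := by
  refine ⟨fun _ => outLayer u, fun _ => 0, fun s hs => ⟨?_, hasDerivAt_const _ _, hV s hs,
    norm_outLayer_le u, by simp⟩⟩
  simp only [outLayer_add_smul]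
  simpa using ((hasDerivAt_id s).smul_const (outLayer u)).const_add (outLayer θ)

/-- The loss along a line in parameter space has a bounded second derivative. -/
theorem empLoss_line_deriv_two {n : ℕ} {φ : ℝ → ℝ} {β Y : ℝ} (hφ : ContDiff ℝ 2 φ)
    (h1 : ∀ z, |deriv φ z| ≤ 1) (h2 : ∀ z, |deriv (deriv φ) z| ≤ β) (hm : 1 ≤ m) (hN : 1 ≤ N)
    (hn : 1 ≤ n) {x : Fin n → EuclideanSpace ℝ (Fin d)} {y : Fin n → ℝ} (hx : ∀ i, ‖x i‖ = 1)
    (hy : 1 / (n : ℝ) * ∑ i, y i ^ 2 ≤ Y) (I : Set ℝ) (θ u : Param d m N) {w V μ A : ℝ}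
    (hw : 0 < w) (hrow : ∀ l i (s : ℝ), w ≤ ‖weightRow (θ + s • u) l i‖)
    (hV1 : 1 ≤ V) (hV : ∀ s ∈ I, ‖outLayer (θ + s • u)‖ ≤ V)
    (hμ1 : 1 ≤ μ) (hμ : 1 / w ≤ μ) (hμ2 : 1 + 1 / w ^ 2 ≤ μ)
    (hA : A = 1 + N * (|φ 0| * √m)) :
    ∃ h₁ h₂ : ℝ → ℝ, ∀ s ∈ I, HasDerivAt (fun s => empLoss φ x y (θ + s • u)) (h₁ s) s ∧
      HasDerivAt h₁ (h₂ s) s ∧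
      |h₂ s| ≤ (16 + 2 * (4 * β + 12) * (2 + Y)) * (N ^ 3 * A ^ 3 * V ^ 2 * μ) * ‖u‖ ^ 2 := by
  have hp : 0 ≤ |φ 0| * √m := by positivity
  have hN1 : (1 : ℝ) ≤ N := by exact_mod_cast hN
  have hA1 : 1 ≤ A := by rw [hA]; nlinarith
  have hβ : 0 ≤ β := (abs_nonneg _).trans (h2 0)
  have hn' : (0 : ℝ) < n := by exact_mod_cast hn
  have hY : 0 ≤ Y := le_trans (by positivity) hy
  set b := ‖u‖ with hb
  have hb0 : 0 ≤ b := norm_nonneg u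
  set q := b / w with hq
  -- `μ` dominates both `1 / w` and `1 / w ^ 2`, so one factor `μ` absorbs all dependence on the row
  -- norms.
  have hqμ : q ≤ b * μ := by
    rw [hq, div_eq_mul_one_div]; gcongr
  have hqμ2 : q ^ 2 ≤ b ^ 2 * μ := by
    rw [hq, div_pow, div_eq_mul_one_div]; gcongr; linarith
  have hq0 : 0 ≤ q := by positivity
  have hf : ∀ j, BoundedC2 I (fun s => predictor φ (θ + s • u) (x j)) (V * A)
      (b * A * (1 + 2 * V * N / w)) (b ^ 2 * (V * N ^ 3 * A ^ 2 * μ * (4 * β + 12))) := by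
    intro j
    refine ((outLayer_line_boundedC2 θ u hV).real_inner
      (layerOut_boundedC2 hφ h1 h2 hm (hx j) I θ u hw hrow hA hq N le_rfl)).mono ?_ ?_ ?_
    · rw [hA]
    · rw [← hA, ← hb]
      apply le_of_eq
      rw [hq]
      field_simp
      ring
    · rw [← hb, zero_mul, add_zero]
      calc _ = N ^ 3 * V * (4 * β + 8) * A ^ 2 * q ^ 2 + 4 * b * N * A * q := by ring
        _ ≤ N ^ 3 * V * (4 * β + 8) * A ^ 2 * (b ^ 2 * μ) +
            4 * b * (N ^ 3 * V) * A ^ 2 * (b * μ) := by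
            gcongr
            · calc (N : ℝ) = N ^ 1 * 1 := by ring
                _ ≤ N ^ 3 * V := by gcongr; norm_num
            · nlinarith
        _ = _ := by ring
  choose f₁ f₂ hf using hf
  refine ⟨fun s => 1 / (n : ℝ) * ∑ j, 2 * ((y j - predictor φ (θ + s • u) (x j)) * -f₁ j s),
    fun s => 1 / (n : ℝ) * ∑ j, 2 * (-f₁ j s * -f₁ j s +
      (y j - predictor φ (θ + s • u) (x j)) * -f₂ j s), fun s hs => ⟨?_, ?_, ?_⟩⟩
  · refine (HasDerivAt.fun_sum fun j _ => ?_).const_mul _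
    refine ((((hf j s hs).1.const_sub (y j))).pow 2).congr_deriv ?_
    norm_num
    ring
  · refine (HasDerivAt.fun_sum fun j _ => ?_).const_mul _
    exact ((((hf j s hs).1.const_sub (y j))).mul ((hf j s hs).2.1.neg)).const_mul 2
  · have hF1 : (b * A * (1 + 2 * V * N / w)) ^ 2 ≤ 8 * (b ^ 2 * (N ^ 3 * A ^ 3 * V ^ 2 * μ)) := by
      have hNV : 1 ≤ V * N := by nlinarith
      have hVN : (1 + 2 * V * N / w) ^ 2 ≤ 8 * (V * N) ^ 2 * μ := by
        calc (1 + 2 * V * N / w) ^ 2 ≤ 2 * 1 + 2 * (2 * V * N / w) ^ 2 := by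
              nlinarith [sq_nonneg (1 - 2 * V * N / w)]
          _ ≤ 2 * (V * N) ^ 2 + 2 * (2 * V * N / w) ^ 2 := by
              gcongr; exact one_le_pow₀ hNV
          _ = (V * N) ^ 2 * (2 + 8 * (1 / w ^ 2)) := by field_simp; ring
          _ ≤ (V * N) ^ 2 * (8 * μ) := by gcongr; linarith
          _ = _ := by ring
      calc _ = b ^ 2 * A ^ 2 * (1 + 2 * V * N / w) ^ 2 := by ring
        _ ≤ b ^ 2 * A ^ 3 * (8 * (V ^ 2 * N ^ 3) * μ) := by
            have hN23 : (N : ℝ) ^ 2 ≤ N ^ 3 := pow_le_pow_right₀ hN1 (by norm_num)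
            gcongr
            · norm_num
            · refine hVN.trans ?_
              rw [mul_pow]
              gcongr
        _ = _ := by ring
    -- The residuals enter to first order, while only the mean of `y j ^ 2` is bounded; `|y j| ≤ 1 +
    -- y j ^ 2` bridges the two.
    have hyj : ∑ j, |y j| ≤ n * (1 + Y) := by
      calc ∑ j, |y j| ≤ ∑ j, (1 + y j ^ 2) := Finset.sum_le_sum fun j _ => by
            nlinarith [sq_abs (y j), sq_nonneg (|y j| - 1), abs_nonneg (y j)]
        _ = n + n * (1 / n * ∑ j, y j ^ 2) := by
            rw [Finset.sum_add_distrib]; simp; field_simp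
        _ ≤ n + n * Y := by gcongr
        _ = _ := by ring
    set F2 := b ^ 2 * (V * N ^ 3 * A ^ 2 * μ * (4 * β + 12)) with hF2
    have hF20 : 0 ≤ F2 := by positivity
    have hterm : ∀ j, |2 * (-f₁ j s * -f₁ j s +
        (y j - predictor φ (θ + s • u) (x j)) * -f₂ j s)| ≤
        2 * (8 * (b ^ 2 * (N ^ 3 * A ^ 3 * V ^ 2 * μ))) + 2 * ((|y j| + V * A) * F2) := by
      intro j
      obtain ⟨-, -, g0, g1, g2⟩ := hf j s hs
      rw [abs_mul, abs_two, ← mul_add]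
      refine mul_le_mul_of_nonneg_left ((abs_add_le _ _).trans (add_le_add ?_ ?_)) zero_le_two
      · rw [neg_mul_neg, ← sq, abs_pow]
        exact (pow_le_pow_left₀ (abs_nonneg _) g1 2).trans hF1
      · rw [abs_mul, abs_neg]
        refine mul_le_mul ((abs_sub _ _).trans ?_) g2 (abs_nonneg _) (by positivity)
        exact add_le_add le_rfl g0
    rw [abs_mul, abs_of_pos (by positivity : 0 < 1 / (n : ℝ))]
    calc _ ≤ 1 / (n : ℝ) * ∑ j, (2 * (8 * (b ^ 2 * (N ^ 3 * A ^ 3 * V ^ 2 * μ))) +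
          2 * ((|y j| + V * A) * F2)) := by
          gcongr
          exact (Finset.abs_sum_le_sum_abs _ _).trans (Finset.sum_le_sum fun j _ => hterm j)
      _ = 16 * (b ^ 2 * (N ^ 3 * A ^ 3 * V ^ 2 * μ)) +
          2 * F2 * (1 / n * ∑ j, |y j| + V * A) := by
          have e : ∑ j, 2 * ((|y j| + V * A) * F2) = 2 * ((∑ j, |y j| + n * (V * A)) * F2) := by
            rw [← Finset.mul_sum, ← Finset.sum_mul, Finset.sum_add_distrib]
            simp
          rw [Finset.sum_add_distrib, e]
          simp only [Finset.sum_const, Finset.card_univ, Fintype.card_fin, nsmul_eq_mul]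
          field_simp
          ring
      -- The constant 16 comes from the squared first derivative of the predictor. The other summand
      -- is residual times second derivative, with `1 + Y + V * A ≤ V * A * (2 + Y)` because `V * A
      -- ≥ 1`.
      _ ≤ 16 * (b ^ 2 * (N ^ 3 * A ^ 3 * V ^ 2 * μ)) + 2 * F2 * (V * A * (2 + Y)) := by
          have : 1 / (n : ℝ) * ∑ j, |y j| ≤ 1 + Y := by
            rw [one_div, inv_mul_le_iff₀ hn']; exact hyj
          have hVA : 1 ≤ V * A := by nlinarith
          gcongr
          nlinarith
      _ = _ := by rw [hF2]; ring

end

/-! ### Scale invariance and orthogonality of the gradient to the weight rows. -/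

section

variable {d m N n : ℕ}

theorem layerOut_congr {φ : ℝ → ℝ} {θ θ' : Param d m N} (x : EuclideanSpace ℝ (Fin d))
    (h : ∀ l i, ∃ c : ℝ, 0 < c ∧ weightRow θ' l i = c • weightRow θ l i) :
    ∀ (l : ℕ) (hl : l ≤ N), layerOut φ θ' x l hl = layerOut φ θ x l hl
  | 0, _ => rfl
  | l + 1, hl => by
    refine congrArg (WithLp.toLp 2) (funext fun i => ?_)
    obtain ⟨c, hc, e⟩ := h ⟨l, hl⟩ i
    rw [layerOut_congr x h l, e, real_inner_smul_left, norm_smul, Real.norm_of_nonneg hc.le,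
      mul_div_mul_left _ _ hc.ne']

/-- The parameter vector that agrees with `θ` on one weight row and vanishes elsewhere. -/
noncomputable def rowPart (θ : Param d m N) (l : Fin N) (i : Fin m) : Param d m N :=
  WithLp.toLp 2 (Sum.elim (fun k => if k.1 = l ∧ k.2.1 = i then θ (Sum.inl k) else 0) fun _ => 0)

theorem weightRow_rowPart (θ : Param d m N) (l l' : Fin N) (i i' : Fin m) :
    weightRow (rowPart θ l i) l' i' = if l' = l ∧ i' = i then weightRow θ l' i' else 0 := by
  ext j
  simp only [weightRow, rowPart, Sum.elim_inl]
  split_ifs <;> rfl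

theorem outLayer_rowPart (θ : Param d m N) (l : Fin N) (i : Fin m) :
    outLayer (rowPart θ l i) = 0 := rfl

theorem inner_rowPart (θ g : Param d m N) (l : Fin N) (i : Fin m) :
    inner ℝ g (rowPart θ l i) = inner ℝ (weightRow g l i) (weightRow θ l i) := by
  have h : ∀ k : Fin N, k ≠ l → ∑ p : Fin m × Fin (width d m k),
      inner ℝ (g (Sum.inl ⟨k, p⟩)) (rowPart θ l i (Sum.inl ⟨k, p⟩)) = 0 := fun k hk =>
    Finset.sum_eq_zero fun p _ => by simp [rowPart, hk]
  rw [PiLp.inner_apply, PiLp.inner_apply, Fintype.sum_sum_type, Fintype.sum_sigma,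
    Fintype.sum_eq_single l h, Fintype.sum_prod_type, Fintype.sum_eq_single i fun k hk =>
      Finset.sum_eq_zero fun p _ => by simp [rowPart, hk]]
  simp [rowPart, weightRow]

/-- `gradient` has the default value 0 at points of non-differentiability, so a nonzero gradient
certifies differentiability. -/
theorem differentiableAt_of_gradient_ne_zero {E : Type*} [NormedAddCommGroup E]
    [InnerProductSpace ℝ E] [CompleteSpace E] {F : E → ℝ} {a : E} (h : gradient F a ≠ 0) :
    DifferentiableAt ℝ F a := by
  by_contra hF
  exact h (gradient_eq_zero_of_not_differentiableAt hF)

theorem hasDerivAt_line {E : Type*} [NormedAddCommGroup E] [InnerProductSpace ℝ E]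
    [CompleteSpace E] {F : E → ℝ} {a : E} (hF : DifferentiableAt ℝ F a) (u : E) :
    HasDerivAt (fun s : ℝ => F (a + s • u)) (inner ℝ (gradient F a) u) 0 := by
  have h1 : HasDerivAt (fun s : ℝ => a + s • u) u 0 := by
    simpa using ((hasDerivAt_id (0 : ℝ)).smul_const u).const_add a
  have h2 : HasFDerivAt F (InnerProductSpace.toDual ℝ E (gradient F a)) (a + (0 : ℝ) • u) := by
    simpa using hF.hasGradientAt.hasFDerivAt
  exact (h2.comp_hasDerivAt (0 : ℝ) h1).congr_deriv (InnerProductSpace.toDual_apply_apply ..)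

/-- The loss does not depend on the lengths of the weight rows, so its gradient is orthogonal to
each of them. -/
theorem inner_weightRow_gradient (φ : ℝ → ℝ) (x : Fin n → EuclideanSpace ℝ (Fin d))
    (y : Fin n → ℝ) {θ : Param d m N} (h : DifferentiableAt ℝ (empLoss φ x y) θ) (l : Fin N)
    (i : Fin m) :
    inner ℝ (weightRow (gradient (empLoss φ x y) θ) l i) (weightRow θ l i) = 0 := by
  rw [← inner_rowPart]
  refine (hasDerivAt_line h (rowPart θ l i)).unique
    ((hasDerivAt_const (0 : ℝ) (empLoss φ x y θ)).congr_of_eventuallyEq ?_)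
  -- For `s > -1` the selected row is scaled by `1 + s > 0`, so the loss is constant near `s = 0`.
  filter_upwards [lt_mem_nhds (show (-1 : ℝ) < 0 by norm_num)] with s hs
  have hrow : ∀ l' i', ∃ c : ℝ, 0 < c ∧
      weightRow (θ + s • rowPart θ l i) l' i' = c • weightRow θ l' i' := by
    intro l' i'
    rw [weightRow_add_smul, weightRow_rowPart]
    split_ifs
    · exact ⟨1 + s, by linarith, by rw [add_smul, one_smul]⟩
    · exact ⟨1, one_pos, by simp⟩
  have hpred : ∀ j, predictor φ (θ + s • rowPart θ l i) (x j) = predictor φ θ (x j) := by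
    intro j
    rw [predictor, predictor, layerOut_congr (x j) hrow, outLayer_add_smul, outLayer_rowPart,
      smul_zero, add_zero]
  simp only [empLoss, hpred]

theorem norm_le_norm_add_smul_of_inner_eq_zero {E : Type*} [NormedAddCommGroup E]
    [InnerProductSpace ℝ E] {a u : E} (h : inner ℝ u a = 0) (s : ℝ) : ‖a‖ ≤ ‖a + s • u‖ := by
  refine (sq_le_sq₀ (norm_nonneg _) (norm_nonneg _)).1 ?_
  rw [norm_add_sq_real, real_inner_smul_right, real_inner_comm, h]
  nlinarith [sq_nonneg ‖s • u‖]

/-- Two applications of the comparison principle for derivatives replace Taylor's formula, so `h₂`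
need not be continuous. -/
theorem le_quadratic_of_second_deriv_le {h h₁ h₂ : ℝ → ℝ} {c K : ℝ} (hc : 0 ≤ c)
    (H : ∀ s ∈ Set.Icc 0 c, HasDerivAt h (h₁ s) s ∧ HasDerivAt h₁ (h₂ s) s ∧ |h₂ s| ≤ K) :
    h c ≤ h 0 + h₁ 0 * c + K / 2 * c ^ 2 := by
  have step : ∀ {F F' G G' : ℝ → ℝ}, (∀ s ∈ Set.Icc 0 c, HasDerivAt F (F' s) s) →
      (∀ s, HasDerivAt G (G' s) s) → F 0 ≤ G 0 → (∀ s ∈ Set.Icc 0 c, F' s ≤ G' s) →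
      ∀ s ∈ Set.Icc 0 c, F s ≤ G s := by
    intro F F' G G' hF hG h0 hle
    exact image_le_of_deriv_right_le_deriv_boundary
      (fun s hs => (hF s hs).continuousAt.continuousWithinAt)
      (fun s hs => (hF s (Set.Ico_subset_Icc_self hs)).hasDerivWithinAt) h0
      (fun s _ => (hG s).continuousAt.continuousWithinAt) (fun s _ => (hG s).hasDerivWithinAt)
      (fun s hs => hle s (Set.Ico_subset_Icc_self hs))
  have s1 := step (G := fun s => h₁ 0 + K * s) (G' := fun _ => K) (fun s hs => (H s hs).2.1)
    (fun s => by simpa using ((hasDerivAt_id s).const_mul K).const_add (h₁ 0)) (by simp)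
    (fun s hs => (le_abs_self _).trans (H s hs).2.2)
  exact step (G := fun s => h 0 + h₁ 0 * s + K / 2 * s ^ 2) (fun s hs => (H s hs).1)
    (fun s => (((hasDerivAt_id s).const_mul (h₁ 0)).const_add (h 0)).add
      ((hasDerivAt_pow 2 s).const_mul (K / 2))) (by simp)
    (fun s hs => (s1 s hs).trans (le_of_eq (by norm_num; ring))) c ⟨hc, le_rfl⟩

/-! ### Constants, the descent estimate and feasibility of the step. -/

theorem minRowNorm_le (θ : Param d m N) (l : Fin N) (i : Fin m) :
    minRowNorm θ ≤ ‖weightRow θ l i‖ :=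
  ciInf_le (Set.finite_range fun k : Fin N × Fin m => ‖weightRow θ k.1 k.2‖).bddBelow (l, i)

theorem minRowNorm_pos (hm : 1 ≤ m) (hN : 1 ≤ N) {θ : Param d m N}
    (h : θ ∈ nondegenerate d m N) : 0 < minRowNorm θ := by
  have : Nonempty (Fin N × Fin m) := ⟨(⟨0, hN⟩, ⟨0, hm⟩)⟩
  obtain ⟨k, hk⟩ := exists_eq_ciInf_of_finite (f := fun k : Fin N × Fin m => ‖weightRow θ k.1 k.2‖)
  rw [minRowNorm, ← hk]
  exact norm_pos_iff.2 (h k.1 k.2)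

theorem minRowNorm_nonneg (θ : Param d m N) : 0 ≤ minRowNorm θ :=
  Real.iInf_nonneg fun _ => norm_nonneg _

theorem empLoss_nonneg (φ : ℝ → ℝ) (x : Fin n → EuclideanSpace ℝ (Fin d)) (y : Fin n → ℝ)
    (θ : Param d m N) : 0 ≤ empLoss φ x y θ :=
  mul_nonneg (by positivity) (Finset.sum_nonneg fun _ _ => sq_nonneg _)

/-- The curvature constant of the square loss. -/
def curvatureConst (β Y : ℝ) : ℝ := 4 * (16 + 2 * (4 * |β| + 12) * (2 + |Y|))

theorem curvatureConst_pos (β Y : ℝ) : 0 < curvatureConst β Y := by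
  rw [curvatureConst]; positivity

theorem smoothParam_pos {C : ℝ} (hC : 0 < C) (φ : ℝ → ℝ) {ρ₁ : ℝ} (hρ : 0 < ρ₁) (hN : 1 ≤ N)
    (θ : Param d m N) : 0 < smoothParam C φ ρ₁ θ := by
  have hN' : (0 : ℝ) < N := by exact_mod_cast hN
  have h0 := minRowNorm_nonneg θ
  have : 0 ≤ min (minRowNorm θ) (minRowNorm θ ^ 2) := le_min h0 (sq_nonneg _)
  have h2 : 0 ≤ max |φ 0| (|φ 0| ^ 2) := le_max_of_le_left (abs_nonneg _)
  rw [smoothParam]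
  positivity

/-- With `t = N * |r| * √m`, one has `(1 + t) ^ 3 ≤ (1 + t) ^ 4 ≤ (2 * (1 + t ^ 2)) ^ 2`, and `t ^
2` is at most the term in `smoothParam`. The resulting 4 is the leading factor of `curvatureConst`.
-/
theorem width_factor_le (m : ℕ) (hN : 1 ≤ N) (r : ℝ) :
    (N : ℝ) ^ 3 * (1 + N * (|r| * √m)) ^ 3 ≤
      4 * ((N : ℝ) ^ 4 * (1 + (N : ℝ) ^ 2 * max |r| (|r| ^ 2) * m) ^ 2) := by
  have hN1 : (1 : ℝ) ≤ N := by exact_mod_cast hN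
  set t := N * (|r| * √m) with ht
  have ht0 : 0 ≤ t := by positivity
  have ht2 : t ^ 2 ≤ (N : ℝ) ^ 2 * max |r| (|r| ^ 2) * m := by
    rw [ht, mul_pow, mul_pow, Real.sq_sqrt (Nat.cast_nonneg m), ← mul_assoc]
    gcongr
    exact le_max_right _ _
  calc (N : ℝ) ^ 3 * (1 + t) ^ 3 ≤ N ^ 4 * (1 + t) ^ 4 := by
        have h1t : 1 ≤ 1 + t := by linarith
        gcongr <;> norm_num
    _ = N ^ 4 * ((1 + t) ^ 2) ^ 2 := by ring
    _ ≤ N ^ 4 * (2 * (1 + t ^ 2)) ^ 2 := by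
        gcongr; nlinarith [sq_nonneg (1 - t)]
    _ ≤ N ^ 4 * (2 * (1 + (N : ℝ) ^ 2 * max |r| (|r| ^ 2) * m)) ^ 2 := by gcongr
    _ = _ := by ring

/-- A gradient step with step size `c` that stays in the ball of output layers decreases the loss
as predicted by the smoothness parameter. -/
theorem empLoss_gradient_step_le {φ : ℝ → ℝ} {β Y C : ℝ} (hC : curvatureConst β Y ≤ C)
    (hφ : ContDiff ℝ 2 φ) (h1 : ∀ z, |deriv φ z| ≤ 1) (h2 : ∀ z, |deriv (deriv φ) z| ≤ β)
    (hm : 1 ≤ m) (hN : 1 ≤ N) (hn : 1 ≤ n) {x : Fin n → EuclideanSpace ℝ (Fin d)} {y : Fin n → ℝ}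
    (hx : ∀ i, ‖x i‖ = 1) (hy : 1 / (n : ℝ) * ∑ i, y i ^ 2 ≤ Y) {ρ₁ c : ℝ} (hρ : 0 < ρ₁)
    (hc : 0 ≤ c) {θ : Param d m N} (hθ : θ ∈ nondegenerate d m N)
    (hdiff : DifferentiableAt ℝ (empLoss φ x y) θ)
    {v₀ : EuclideanSpace ℝ (Fin (width d m N))} (hv₀ : ‖v₀‖ = 1)
    (hv : outLayer θ ∈ Metric.closedBall v₀ ρ₁)
    (hv' : outLayer (θ - c • gradient (empLoss φ x y) θ) ∈ Metric.closedBall v₀ ρ₁) :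
    empLoss φ x y (θ - c • gradient (empLoss φ x y) θ) ≤ empLoss φ x y θ -
      c * ‖gradient (empLoss φ x y) θ‖ ^ 2 +
      smoothParam C φ ρ₁ θ * ‖gradient (empLoss φ x y) θ‖ ^ 2 / 2 * c ^ 2 := by
  set g := gradient (empLoss φ x y) θ with hg
  have hβ : 0 ≤ β := (abs_nonneg _).trans (h2 0)
  have hY : 0 ≤ Y := le_trans (by positivity) hy
  have hw := minRowNorm_pos hm hN hθ
  set w := minRowNorm θ with hwdef
  have hrow : ∀ l i (s : ℝ), w ≤ ‖weightRow (θ + s • -g) l i‖ := by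
    intro l i s
    have h0 : inner ℝ (weightRow g l i) (weightRow θ l i) = 0 :=
      inner_weightRow_gradient φ x y hdiff l i
    have e : θ + s • -g = θ + (-s) • g := by rw [smul_neg, neg_smul]
    rw [e, weightRow_add_smul]
    exact (minRowNorm_le θ l i).trans (norm_le_norm_add_smul_of_inner_eq_zero h0 _)
  have hmin : 0 < min w (w ^ 2) := lt_min hw (by positivity)
  have hμw : 1 / w ≤ 1 + 1 / min w (w ^ 2) :=
    (one_div_le_one_div_of_le hmin (min_le_left _ _)).trans (by linarith)
  have hμw2 : 1 + 1 / w ^ 2 ≤ 1 + 1 / min w (w ^ 2) :=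
    add_le_add le_rfl (one_div_le_one_div_of_le hmin (min_le_right _ _))
  have hμ1 : 1 ≤ 1 + 1 / min w (w ^ 2) := by
    have : 0 < 1 / min w (w ^ 2) := by positivity
    linarith
  have hV : ∀ s ∈ Set.Icc 0 c, ‖outLayer (θ + s • -g)‖ ≤ 1 + ρ₁ := by
    intro s hs
    have hmem : outLayer (θ + s • -g) ∈ Metric.closedBall v₀ ρ₁ := by
      -- The point is the convex combination of the endpoints with weights `1 - s / c` and `s / c`;
      -- the case `c = 0` is separate because of the division.
      rcases hc.eq_or_lt with h0 | h0
      · obtain rfl : s = 0 := le_antisymm (h0 ▸ hs.2) hs.1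
        simpa using hv
      · have hcv := (convex_closedBall v₀ ρ₁) hv hv' (sub_nonneg.2 (div_le_one_of_le₀ hs.2 hc))
          (div_nonneg hs.1 hc) (sub_add_cancel 1 (s / c))
        convert hcv using 1
        have e : θ - c • g = θ + c • -g := by rw [smul_neg, sub_eq_add_neg]
        rw [e, outLayer_add_smul, outLayer_add_smul, smul_add, ← add_assoc, ← add_smul,
          sub_add_cancel, one_smul, smul_smul, div_mul_cancel₀ _ h0.ne']
    have := norm_le_norm_add_norm_sub' (outLayer (θ + s • -g)) v₀
    rw [Metric.mem_closedBall, dist_eq_norm] at hmem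
    linarith
  obtain ⟨h₁, h₂, H⟩ := empLoss_line_deriv_two hφ h1 h2 hm hN hn hx hy (Set.Icc 0 c) θ (-g) hw
    hrow (by linarith : 1 ≤ 1 + ρ₁) hV hμ1 hμw hμw2 rfl
  have hK : (16 + 2 * (4 * β + 12) * (2 + Y)) * (N ^ 3 * (1 + N * (|φ 0| * √m)) ^ 3 *
      (1 + ρ₁) ^ 2 * (1 + 1 / min w (w ^ 2))) ≤ smoothParam C φ ρ₁ θ := by
    have hcc : curvatureConst β Y = 4 * (16 + 2 * (4 * β + 12) * (2 + Y)) := by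
      rw [curvatureConst, abs_of_nonneg hβ, abs_of_nonneg hY]
    have hmax : 0 ≤ max |φ 0| (|φ 0| ^ 2) := le_max_of_le_left (abs_nonneg _)
    calc _ ≤ (16 + 2 * (4 * β + 12) * (2 + Y)) *
          (4 * ((N : ℝ) ^ 4 * (1 + (N : ℝ) ^ 2 * max |φ 0| (|φ 0| ^ 2) * m) ^ 2) *
          (1 + ρ₁) ^ 2 * (1 + 1 / min w (w ^ 2))) := by
          have := width_factor_le m hN (φ 0)
          gcongr ?_ * (?_ * _ * _)
      _ = curvatureConst β Y * ((N : ℝ) ^ 4 *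
          (1 + (N : ℝ) ^ 2 * max |φ 0| (|φ 0| ^ 2) * m) ^ 2 * (1 + ρ₁) ^ 2 *
          (1 + 1 / min w (w ^ 2))) := by rw [hcc]; ring
      _ ≤ _ := by
          rw [smoothParam, ← hwdef]
          gcongr
  have h10 : h₁ 0 = -‖g‖ ^ 2 := by
    refine (H 0 ⟨le_rfl, hc⟩).1.unique ?_
    have := hasDerivAt_line hdiff (-g)
    rwa [← hg, inner_neg_right, real_inner_self_eq_norm_sq] at this
  have hq := le_quadratic_of_second_deriv_le hc fun s hs => ⟨(H s hs).1, (H s hs).2.1,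
    (H s hs).2.2.trans (mul_le_mul_of_nonneg_right hK (sq_nonneg _))⟩
  simp only [zero_smul, norm_neg, smul_neg, ← sub_eq_add_neg, sub_zero, h10] at hq
  linarith

/-- The subtracted term is nonnegative. Besides positivity, this upper bound is all that is used
about the restricted strong convexity parameter. -/
theorem rscParam_le {C : ℝ} (hC : 0 ≤ C) (φ : ℝ → ℝ) (x : Fin n → EuclideanSpace ℝ (Fin d))
    (y : Fin n → ℝ) (κ : ℝ) {ρ₁ ρ₂ : ℝ} (hρ₁ : 0 < ρ₁) (hρ₂ : 0 < ρ₂) (θ : Param d m N) :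
    rscParam C φ x y κ ρ₁ ρ₂ θ ≤
      κ ^ 2 / 2 * (‖gradient (empLoss φ x y) θ‖ ^ 2 / empLoss φ x y θ) := by
  have h0 := minRowNorm_nonneg θ
  have : 0 ≤ min (minRowNorm θ) (minRowNorm θ ^ 2) := le_min h0 (sq_nonneg _)
  have h2 : 0 ≤ max |φ 0| (|φ 0| ^ 2) := le_max_of_le_left (abs_nonneg _)
  rw [rscParam]
  refine sub_le_self _ ?_
  positivity

/-- A gradient step points opposite to the gradient, so the cosine is -1 and its absolute value is
at least `κ`. -/
theorem sub_smul_mem_coneSet (F : Param d m N → ℝ) {κ c : ℝ} (hκ : κ ≤ 1) (hc : 0 < c)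
    {θ : Param d m N} (hg : gradient F θ ≠ 0) : θ - c • gradient F θ ∈ coneSet F κ θ := by
  have e : θ - c • gradient F θ - θ = (-c) • gradient F θ := by
    rw [neg_smul]; abel
  rw [coneSet, Set.mem_ofPred_eq, e,
    InnerProductGeometry.angle_smul_left_of_neg _ _ (neg_neg_of_pos hc),
    InnerProductGeometry.angle_neg_self_of_nonzero hg, Real.cos_pi]
  simpa using hκ

theorem sub_smul_gradient_mem_nondegenerate (φ : ℝ → ℝ) (x : Fin n → EuclideanSpace ℝ (Fin d))
    (y : Fin n → ℝ) {θ : Param d m N} (hθ : θ ∈ nondegenerate d m N)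
    (h : DifferentiableAt ℝ (empLoss φ x y) θ) (c : ℝ) :
    θ - c • gradient (empLoss φ x y) θ ∈ nondegenerate d m N := by
  intro l i
  rw [sub_eq_add_neg, ← neg_smul, weightRow_add_smul]
  exact norm_pos_iff.1 ((norm_pos_iff.2 (hθ l i)).trans_le
    (norm_le_norm_add_smul_of_inner_eq_zero (inner_weightRow_gradient φ x y h l i) _))

end

end WeightNorm

/-! ### The loss reduction theorem. -/

theorem mainTheorem7 (βφ Y : ℝ) :
    ∃ C₀ : ℝ, 0 < C₀ ∧
      ∀ Cα : ℝ, 0 ≤ Cα → ∀ Cβ : ℝ, C₀ ≤ Cβ →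
      ∀ (d m N n : ℕ), 1 ≤ m → 1 ≤ N → 1 ≤ n →
      ∀ φ : ℝ → ℝ, ContDiff ℝ 2 φ →
        (∀ z, |deriv φ z| ≤ 1) → (∀ z, |deriv (deriv φ) z| ≤ βφ) →
      ∀ (x : Fin n → EuclideanSpace ℝ (Fin d)) (y : Fin n → ℝ),
        (∀ i, ‖x i‖ = 1) → 1 / (n : ℝ) * ∑ i, y i ^ 2 ≤ Y →
      ∀ κ ρ₁ ρ₂ : ℝ, 0 < κ → κ ≤ 1 → 0 < ρ₁ → 0 < ρ₂ →
      ∀ (T : ℕ) (θ : ℕ → WeightNorm.Param d m N) (ω : ℕ → ℝ),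
        θ 0 ∈ WeightNorm.nondegenerate d m N →
        ‖WeightNorm.outLayer (θ 0)‖ = 1 →
        (∀ t < T, 0 < WeightNorm.rscParam Cα φ x y κ ρ₁ ρ₂ (θ t)) →
        (∀ t < T, 0 < ω t ∧ ω t < 2) →
        (∀ t < T, θ (t + 1) = θ t - (ω t / WeightNorm.smoothParam Cβ φ ρ₁ (θ t)) •
          gradient (WeightNorm.empLoss φ x y) (θ t)) →
        (∀ t ≤ T, WeightNorm.outLayer (θ t) ∈
          Metric.closedBall (WeightNorm.outLayer (θ 0)) ρ₁) →
        (∀ t < T, θ (t + 1) ∈ Metric.closedBall (θ t) ρ₂) →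
      ∀ θstar ∈ WeightNorm.feasibleSet (WeightNorm.outLayer (θ 0)) ρ₁,
        IsMinOn (WeightNorm.empLoss φ x y)
          (WeightNorm.feasibleSet (WeightNorm.outLayer (θ 0)) ρ₁) θstar →
      ∀ t < T,
      ∀ θbar ∈ WeightNorm.coneSet (WeightNorm.empLoss φ x y) κ (θ t) ∩
          Metric.closedBall (θ t) ρ₂ ∩
          WeightNorm.feasibleSet (WeightNorm.outLayer (θ 0)) ρ₁,
        IsMinOn (WeightNorm.empLoss φ x y)
          (WeightNorm.coneSet (WeightNorm.empLoss φ x y) κ (θ t) ∩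
            Metric.closedBall (θ t) ρ₂ ∩
            WeightNorm.feasibleSet (WeightNorm.outLayer (θ 0)) ρ₁) θbar →
      ∀ γ : ℝ,
        γ = (WeightNorm.empLoss φ x y θbar - WeightNorm.empLoss φ x y θstar) /
          (WeightNorm.empLoss φ x y (θ t) - WeightNorm.empLoss φ x y θstar) →
        WeightNorm.empLoss φ x y θstar < WeightNorm.empLoss φ x y (θ t) ∧
        0 ≤ γ ∧ γ < 1 ∧
        WeightNorm.empLoss φ x y (θ (t + 1)) - WeightNorm.empLoss φ x y θstar ≤
          (1 - WeightNorm.rscParam Cα φ x y κ ρ₁ ρ₂ (θ t) /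
              WeightNorm.smoothParam Cβ φ ρ₁ (θ t) * ω t * (1 - γ) * (2 - ω t)) *
            (WeightNorm.empLoss φ x y (θ t) - WeightNorm.empLoss φ x y θstar) ∧
        1 - WeightNorm.rscParam Cα φ x y κ ρ₁ ρ₂ (θ t) /
            WeightNorm.smoothParam Cβ φ ρ₁ (θ t) * ω t * (1 - γ) * (2 - ω t) < 1 := by
  open WeightNorm in
  refine ⟨curvatureConst βφ Y, curvatureConst_pos βφ Y, ?_⟩
  intro Cα hCα Cβ hCβ d m N n hm hN hn φ hφ h1 h2 x y hx hy κ ρ₁ ρ₂ hκ0 hκ1 hρ₁ hρ₂ T θ ω hθ0 hv0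
    hα hω hstep hball hρball θstar hstar hmin t ht θbar hbar hbarmin γ hγ
  -- A vanishing gradient would make `rscParam` nonpositive. Positivity of `α` thus also provides
  -- differentiability along the iterates.
  have hg : ∀ t < T, gradient (empLoss φ x y) (θ t) ≠ 0 := by
    intro t ht h0
    have h := (hα t ht).trans_le (rscParam_le hCα φ x y κ hρ₁ hρ₂ (θ t))
    rw [h0] at h
    simp at h
  have hnd : ∀ t ≤ T, θ t ∈ nondegenerate d m N := by
    intro t
    induction t with
    | zero => exact fun _ => hθ0
    | succ t ih =>
      intro ht
      rw [hstep t ht]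
      exact sub_smul_gradient_mem_nondegenerate φ x y (ih (Nat.le_of_succ_le ht))
        (differentiableAt_of_gradient_ne_zero (hg t ht)) _
  set g := gradient (empLoss φ x y) (θ t) with hgdef
  set β := smoothParam Cβ φ ρ₁ (θ t) with hβdef
  set α := rscParam Cα φ x y κ ρ₁ ρ₂ (θ t) with hαdef
  have hβ : 0 < β := smoothParam_pos ((curvatureConst_pos βφ Y).trans_le hCβ) φ hρ₁ hN (θ t)
  have hα' : 0 < α := hα t ht
  obtain ⟨hω0, hω2⟩ := hω t ht
  have hc : 0 < ω t / β := div_pos hω0 hβ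
  have hg0 : g ≠ 0 := hg t ht
  have hgpos : 0 < ‖g‖ ^ 2 := pow_pos (norm_pos_iff.2 hg0) 2
  have hdescent : empLoss φ x y (θ (t + 1)) ≤
      empLoss φ x y (θ t) - ω t * (2 - ω t) / β * (‖g‖ ^ 2 / 2) := by
    have h := empLoss_gradient_step_le hCβ hφ h1 h2 hm hN hn hx hy hρ₁ hc.le (hnd t ht.le)
      (differentiableAt_of_gradient_ne_zero hg0) hv0 (hball t ht.le)
      (hstep t ht ▸ hball (t + 1) ht)
    rw [← hgdef, ← hβdef, ← hstep t ht] at h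
    refine h.trans (le_of_eq ?_)
    field_simp
    ring
  have hdec : 0 < ω t * (2 - ω t) / β := div_pos (mul_pos hω0 (by linarith)) hβ
  have hlt : empLoss φ x y (θ (t + 1)) < empLoss φ x y (θ t) := by nlinarith
  have hfeas : θ (t + 1) ∈ feasibleSet (outLayer (θ 0)) ρ₁ := ⟨hnd (t + 1) ht, hball (t + 1) ht⟩
  have hstar_le : empLoss φ x y θstar ≤ empLoss φ x y θbar := hmin hbar.2
  have hbar_le : empLoss φ x y θbar ≤ empLoss φ x y (θ (t + 1)) :=
    hbarmin ⟨⟨by rw [hstep t ht]; exact sub_smul_mem_coneSet _ hκ1 hc hg0, hρball t ht⟩, hfeas⟩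
  have hgap : empLoss φ x y θstar < empLoss φ x y (θ t) := by linarith
  have hgap' : 0 < empLoss φ x y (θ t) - empLoss φ x y θstar := sub_pos.2 hgap
  have hγ0 : 0 ≤ γ := hγ ▸ div_nonneg (sub_nonneg.2 hstar_le) hgap'.le
  have hγ1 : γ < 1 := by
    rw [hγ, div_lt_one hgap']
    linarith
  have hγgap : (1 - γ) * (empLoss φ x y (θ t) - empLoss φ x y θstar) =
      empLoss φ x y (θ t) - empLoss φ x y θbar := by
    rw [hγ]
    field_simp
    ring
  -- The loss at `θbar` is dropped by nonnegativity; the loss at `θ t` then cancels the denominator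
  -- in the bound for `α`, and `κ ^ 2 ≤ 1`.
  have hrsc : α * (empLoss φ x y (θ t) - empLoss φ x y θbar) ≤ ‖g‖ ^ 2 / 2 := by
    have hL : 0 < empLoss φ x y (θ t) := (empLoss_nonneg φ x y _).trans_lt hgap
    calc α * (empLoss φ x y (θ t) - empLoss φ x y θbar) ≤
          κ ^ 2 / 2 * (‖g‖ ^ 2 / empLoss φ x y (θ t)) * empLoss φ x y (θ t) := by
          refine mul_le_mul (rscParam_le hCα φ x y κ hρ₁ hρ₂ (θ t))
            (sub_le_self _ (empLoss_nonneg φ x y _)) (by linarith) (by positivity)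
      _ = κ ^ 2 * (‖g‖ ^ 2 / 2) := by field_simp
      _ ≤ ‖g‖ ^ 2 / 2 := mul_le_of_le_one_left (by positivity) (pow_le_one₀ hκ0.le hκ1)
  refine ⟨hgap, hγ0, hγ1, ?_, ?_⟩
  · have e : (1 - α / β * ω t * (1 - γ) * (2 - ω t)) *
        (empLoss φ x y (θ t) - empLoss φ x y θstar) =
        empLoss φ x y (θ t) - empLoss φ x y θstar - ω t * (2 - ω t) / β *
          (α * ((1 - γ) * (empLoss φ x y (θ t) - empLoss φ x y θstar))) := by ring
    rw [e, hγgap]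
    linarith [mul_le_mul_of_nonneg_left hrsc hdec.le]
  · have : 0 < α / β * ω t * (1 - γ) * (2 - ω t) :=
      mul_pos (mul_pos (mul_pos (div_pos hα' hβ) hω0) (by linarith)) (by linarith)
    linarith
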